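/- Sublinear achievability for Error Metric 3. Let $\gamma\in(0,1)$, $P>0$ and $\nu>0$. For $x\in\mathbb C^M$ write $\operatorname{supp}(x)=\{i: x_i\neq 0\}$ and $\|x\|_0=|\operatorname{supp}(x)|$. Observe $y=Ax+n$, where $A$ is an $N\times M$ matrix with i.i.d. circularly-symmetric complex Gaussian entries $a_{ij}\sim\mathcal N_{\mathbb C}(0,1)$ and $n\sim\mathcal N_{\mathbb C}(0,\nu^2 I_N)$ is independent of $A$. For $J\subset\{1,\dots,M\}$ let $A_J$ be the matrix formed by the columns of $A$ with index in $J$, and let $\Pi^\perp_{A_J}$ be the orthogonal projection onto the orthogonal complement of the column space of $A_J$. For $\delta>0$, $y$ and a set $J$ with $|J|=L$ are called $\delta$-jointly typical if $\operatorname{rank}(A_J)=L$ and $$\Big|\tfrac1N\|\Pi^\perp_{A_J}y\|^2-\tfrac{N-L}{N}\nu^2\Big|<\delta .$$ A $\delta$-joint-typicality decoder outputs a set $\mathcal D(y)$ that is $\delta$-jointly typical with $y$ whenever there is one, chosen by an arbitrary tie-breaking rule from the family of all such sets (and an arbitrary set, depending only on $M$, if there is none). It makes an error for $x$ (with respect to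 Error Metric 3) unless $$\sum_{k\in\mathcal D(y)\cap\operatorname{supp}(x)}|x_k|^2>(1-\gamma)\|x\|_2^2 ,$$ and $p_{\mathrm{err}}(\mathcal D\,|\,x)$ denotes the probability of error, averaged over $A$ and $n$. Then there are constants $C_5'>0$ and $\delta>0$ that depend only on $\gamma$, $P$ and $\nu$, such that the following holds for every sequence $\{x^{(M)}\in\mathbb C^M\}_{M\ge1}$ with $\|x^{(M)}\|_2^2=P$ for all $M$ and with $L=L(M)=\|x^{(M)}\|_0=o(M)$, and for every sequence $N=N(M)$ of positive integers. If $N\succ C_5'\,L\log(M-L)$, that is, if $N>C_5'\,L\log(M-L)$ for all sufficiently large $M$, then every $\delta$-joint-typicality decoder achieves asymptotic reliable recovery: $$p_{\mathrm{err}}(\mathcal D\,|\,x^{(M)})\to0\qquad\text{as } M\to\infty .$$ -/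

import Mathlib

open MeasureTheory ProbabilityTheory Filter Topology Asymptotics
open scoped NNReal ENNReal

noncomputable section

namespace SparseRecovery

/-- The support of a vector `x ∈ ℂ^M`. -/
def supp {M : ℕ} (x : Fin M → ℂ) : Finset (Fin M) :=
  Finset.univ.filter (fun i => x i ≠ 0)

/-- The total power `‖x‖₂²` of a signal `x ∈ ℂ^M`. -/
def power {M : ℕ} (x : Fin M → ℂ) : ℝ := ∑ k, ‖x k‖ ^ 2

/-- The circularly-symmetric complex Gaussian law `𝒩_C(0, v)`: the real and the imaginary part
are independent real centred Gaussians, each of variance `v / 2`. -/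
def complexGaussian (v : ℝ≥0) : Measure ℂ :=
  ((gaussianReal 0 (v / 2)).prod (gaussianReal 0 (v / 2))).map
    Complex.measurableEquivRealProd.symm

/-- The law of an `N × M` Gaussian measurement matrix: i.i.d. entries with law `𝒩_C(0, 1)`. -/
def gaussianMatrix (N M : ℕ) : Measure (Fin N → Fin M → ℂ) :=
  Measure.pi fun _ => Measure.pi fun _ => complexGaussian 1

/-- The law `𝒩_C(0, ν² I_N)` of the noise: i.i.d. entries with law `𝒩_C(0, ν²)`. -/
def noise (N : ℕ) (ν : ℝ) : Measure (Fin N → ℂ) :=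
  Measure.pi fun _ => complexGaussian ⟨ν ^ 2, sq_nonneg ν⟩

/-- The noisy observation `y = A x + n`. -/
def observation {N M : ℕ} (A : Matrix (Fin N) (Fin M) ℂ) (x : Fin M → ℂ) (n : Fin N → ℂ) :
    Fin N → ℂ :=
  A.mulVec x + n

/-- The matrix `A_J` whose columns are the columns of `A` with index in `J`. -/
def columns {N M : ℕ} (A : Matrix (Fin N) (Fin M) ℂ) (J : Finset (Fin M)) :
    Matrix (Fin N) J ℂ :=
  A.submatrix id (fun j => (j : Fin M))

/-- The subspace of `ℂ^N` (with its Euclidean structure) spanned by the columns of `A_J`. -/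
def columnSpace {N M : ℕ} (A : Matrix (Fin N) (Fin M) ℂ) (J : Finset (Fin M)) :
    Submodule ℂ (EuclideanSpace ℂ (Fin N)) :=
  Submodule.span ℂ (Set.range fun j : J => WithLp.toLp 2 ((columns A J).col j))

/-- The observation `y` and the index set `J` are `δ`-jointly typical (for sparsity `L`, noise
variance `ν²` and measurement matrix `A`). Here `(columnSpace A J)ᗮ.starProjection` is the
orthogonal projection onto the orthogonal complement of the span of the columns of `A_J`. -/
def JointlyTypical {N M : ℕ} (δ ν : ℝ) (L : ℕ) (A : Matrix (Fin N) (Fin M) ℂ)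
    (y : Fin N → ℂ) (J : Finset (Fin M)) : Prop :=
  J.card = L ∧ (columns A J).rank = L ∧
    |1 / (N : ℝ) * ‖(columnSpace A J)ᗮ.starProjection (WithLp.toLp 2 y)‖ ^ 2
      - ((N : ℝ) - (L : ℝ)) / (N : ℝ) * ν ^ 2| < δ

/-- A decoder estimates the support of the signal from the measurement matrix `A` and the
observation `y`. -/
abbrev Decoder (N M : ℕ) : Type :=
  Matrix (Fin N) (Fin M) ℂ → (Fin N → ℂ) → Finset (Fin M)

open Classical in
/-- The family of all index sets that are `δ`-jointly typical with `y`. -/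
def typicalSets {N M : ℕ} (δ ν : ℝ) (L : ℕ) (A : Matrix (Fin N) (Fin M) ℂ)
    (y : Fin N → ℂ) : Finset (Finset (Fin M)) :=
  Finset.univ.filter (fun J => JointlyTypical δ ν L A y J)

/-- A tie-breaking rule: it picks one member of every non-empty family of index sets (and an
arbitrary index set for the empty family). -/
def IsTieBreaking {M : ℕ} (sel : Finset (Finset (Fin M)) → Finset (Fin M)) : Prop :=
  ∀ S, S.Nonempty → sel S ∈ S

/-- The joint-typicality decoder: among the index sets that are `δ`-jointly typical with the
observation it outputs the one that the rule `sel` picks. -/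
def typicalityDecoder {N M : ℕ} (δ ν : ℝ) (L : ℕ)
    (sel : Finset (Finset (Fin M)) → Finset (Fin M)) : Decoder N M :=
  fun A y => sel (typicalSets δ ν L A y)

/-- Success in the sense of Error Metric 3: the recovered index set `J` carries more than a
fraction `1 - γ` of the energy of `x`. -/
def EnergyRecovered {M : ℕ} (γ : ℝ) (x : Fin M → ℂ) (J : Finset (Fin M)) : Prop :=
  (1 - γ) * power x < ∑ k ∈ J ∩ supp x, ‖x k‖ ^ 2

/-- `p_err(A | x)`: the probability over the noise that the decoder `D` fails with respect to
Error Metric 3, for a fixed measurement matrix `A`. -/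
def pErrGiven {N M : ℕ} (γ ν : ℝ) (D : Decoder N M) (x : Fin M → ℂ)
    (A : Matrix (Fin N) (Fin M) ℂ) : ℝ≥0∞ :=
  noise N ν {n | ¬ EnergyRecovered γ x (D A (observation A x n))}

/-- `p_err(D | x)`: the error probability averaged over the Gaussian measurement matrices. -/
def pErr {N M : ℕ} (γ ν : ℝ) (D : Decoder N M) (x : Fin M → ℂ) : ℝ≥0∞ :=
  ∫⁻ A, pErrGiven γ ν D x (Matrix.of A) ∂(gaussianMatrix N M)

/-- Asymptotic reliable recovery of the sequence `x` by the decoders `D`, with respect to Error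
Metric 3. -/
def AsymptoticReliableRecovery (γ ν : ℝ) (N : ℕ → ℕ) (D : ∀ M, Decoder (N M) M)
    (x : ∀ M, Fin M → ℂ) : Prop :=
  Tendsto (fun M => pErr γ ν (D M) (x M)) atTop (𝓝 0)

/-- The relation `f ≻ g` for non-negative functions. It is used as a hypothesis only, and
monotonicity of `f` and `g` is not required. -/
def AsympGT (f g : ℕ → ℝ) : Prop :=
  (∀ t, f t = 0 ∧ g t = 0) ∨
    ((∀ t, 0 ≤ f t ∧ 0 ≤ g t) ∧ ∃ t₀, ∀ t > t₀, 1 < f t / g t)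

end SparseRecovery

end

noncomputable section

namespace SparseRecovery

/-! ### Complex Gaussian measures -/

/-! Projecting `y` off the columns in `J` removes the part of `x` carried by `J`. What remains comes
from `w = ∑_{k ∉ J} x_k a_k + n`, which is white Gaussian of variance `s² = ν² + ∑_{k ∉ J} |x_k|²`
and independent of `A_J`. Given `A_J`, the residual energy is therefore a sum of squared moduli of
i.i.d. complex Gaussians of variance `s²`, one for each dimension of the complement of the column
space.

For `J = supp x` one has `s = ν`, and Chernoff bounds on both sides show that the true support is
typical up to an exponentially small probability in `N`. A set that misses a fraction `γ` of the
energy has `s² ≥ ν² + γP`, while typicality forces its residual below `(N - L)ν² + Nδ`; this is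
again exponentially unlikely. There are at most `M^L` such sets, and the resulting factor `exp (L
log M)` is absorbed by `N > C L log (M - L)`, because `L = o(M)` makes the two logarithms
comparable.

The independence is `map_splitMap`, the moment computation `lintegral_exp_mul_residual`, the almost
sure full rank `ae_rank_columns`, the union bound `pErr_le`, and its explicit form `pErr_le_exp`. -/

instance isProbabilityMeasure_complexGaussian (v : ℝ≥0) :
    IsProbabilityMeasure (complexGaussian v) :=
  Measure.isProbabilityMeasure_map Complex.measurableEquivRealProd.symm.measurable.aemeasurable

instance isProbabilityMeasure_gaussianMatrix (N M : ℕ) :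
    IsProbabilityMeasure (gaussianMatrix N M) := by
  unfold gaussianMatrix; infer_instance

theorem noise_eq_pi (N : ℕ) (ν : ℝ) :
    noise N ν = Measure.pi fun _ => complexGaussian (ν ^ 2).toNNReal := by
  rw [Real.toNNReal_of_nonneg (sq_nonneg ν)]; rfl

instance isProbabilityMeasure_noise (N : ℕ) (ν : ℝ) : IsProbabilityMeasure (noise N ν) := by
  rw [noise_eq_pi]; infer_instance

theorem charFunDual_eq_charFun_apply_one (μ : Measure ℝ) (L : StrongDual ℝ ℝ) :
    charFunDual μ L = charFun μ (L 1) := by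
  rw [charFunDual_apply, charFun_apply_real]
  congr with x
  have : L x = L 1 * x := by
    conv_lhs => rw [show x = x • (1 : ℝ) by simp, map_smul, smul_eq_mul, mul_comm]
  rw [this, Complex.ofReal_mul]

/-- The squared norm of a real-linear functional on `ℂ`. -/
def dualSq (L : StrongDual ℝ ℂ) : ℝ := L 1 ^ 2 + L Complex.I ^ 2

theorem strongDual_complex_apply (L : StrongDual ℝ ℂ) (z : ℂ) :
    L z = z.re * L 1 + z.im * L Complex.I := by
  have : z = z.re • (1 : ℂ) + z.im • Complex.I := by
    simp [Complex.re_add_im]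
  conv_lhs => rw [this]
  simp only [map_add, map_smul, smul_eq_mul]

theorem charFunDual_complexGaussian (v : ℝ≥0) (L : StrongDual ℝ ℂ) :
    charFunDual (complexGaussian v) L = Complex.exp ((-(v * dualSq L / 4) : ℝ)) := by
  have h : complexGaussian v = ((gaussianReal 0 (v / 2)).prod (gaussianReal 0 (v / 2))).map
      (Complex.equivRealProdCLM.symm : ℝ × ℝ →L[ℝ] ℂ) := rfl
  rw [h, charFunDual_map, charFunDual_prod, charFunDual_eq_charFun_apply_one,
    charFunDual_eq_charFun_apply_one, charFun_gaussianReal, charFun_gaussianReal,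
    ← Complex.exp_add]
  have h1 : ((1 : ℝ) : ℂ) + ((0 : ℝ) : ℂ) * Complex.I = 1 := by simp
  have h2 : ((0 : ℝ) : ℂ) + ((1 : ℝ) : ℂ) * Complex.I = Complex.I := by simp
  simp only [ContinuousLinearMap.comp_apply, ContinuousLinearMap.inl_apply,
    ContinuousLinearMap.inr_apply, ContinuousLinearEquiv.coe_coe,
    Complex.equivRealProdCLM_symm_apply, h1, h2, dualSq]
  push_cast
  ring_nf

theorem charFunDual_noise (N : ℕ) (ν : ℝ) (L : StrongDual ℝ (Fin N → ℂ)) :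
    charFunDual (noise N ν) L =
      Complex.exp ((-(ν ^ 2 * (∑ i, dualSq (L.comp (.single ℝ (fun _ => ℂ) i))) / 4) : ℝ)) := by
  rw [noise_eq_pi, charFunDual_pi]
  simp_rw [charFunDual_complexGaussian]
  rw [← Complex.exp_sum, ← Complex.ofReal_sum, Finset.sum_neg_distrib, Finset.mul_sum,
    Finset.sum_div, Real.coe_toNNReal _ (sq_nonneg ν)]

theorem charFunDual_gaussianMatrix (N M : ℕ) (L : StrongDual ℝ (Fin N → Fin M → ℂ)) :
    charFunDual (gaussianMatrix N M) L =
      Complex.exp ((-((∑ i, ∑ k, dualSq ((L.comp (.single ℝ (fun _ => Fin M → ℂ) i)).comp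
        (.single ℝ (fun _ => ℂ) k))) / 4) : ℝ)) := by
  rw [gaussianMatrix, charFunDual_pi]
  simp_rw [charFunDual_pi, charFunDual_complexGaussian]
  simp_rw [← Complex.exp_sum, ← Complex.ofReal_sum, Finset.sum_neg_distrib,
    Finset.sum_div, NNReal.coe_one, one_mul]

/-- Circular symmetry in dual form: the phase of a coefficient `x_k` is invisible to the Gaussian
law, so only `‖x_k‖ ^ 2` enters the variance. -/
theorem dualSq_of_apply_eq_mul {L L' : StrongDual ℝ ℂ} (w : ℂ) (h : ∀ z, L' z = L (w * z)) :
    dualSq L' = ‖w‖ ^ 2 * dualSq L := by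
  rw [dualSq, dualSq, h, h, strongDual_complex_apply L (w * 1),
    strongDual_complex_apply L (w * Complex.I), ← Complex.normSq_eq_norm_sq, Complex.normSq_apply]
  simp
  ring

/-- The matrix `A` with the columns outside `J` replaced by zero. -/
def mask {N M : ℕ} (J : Finset (Fin M)) (A : Fin N → Fin M → ℂ) : Fin N → Fin M → ℂ :=
  fun i k => if k ∈ J then A i k else 0

/-- The columns in `J`, together with the part of the observation that is due to the noise and to
the columns outside `J`. -/
def splitMap {N M : ℕ} (J : Finset (Fin M)) (x : Fin M → ℂ) :
    (Fin N → Fin M → ℂ) × (Fin N → ℂ) →L[ℝ] (Fin N → Fin M → ℂ) × (Fin N → ℂ) :=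
  LinearMap.toContinuousLinearMap
    { toFun := fun p => (mask J p.1, fun i => (∑ k ∈ Jᶜ, x k * p.1 i k) + p.2 i)
      map_add' := fun p q => by
        ext i
        · simp only [mask, Prod.fst_add, Pi.add_apply]; split_ifs <;> simp
        · simp only [Prod.fst_add, Prod.snd_add, Pi.add_apply, mul_add, Finset.sum_add_distrib]
          ring
      map_smul' := fun r p => by
        ext i
        · simp [mask]
        · simp [Finset.mul_sum, mul_left_comm] }

theorem splitMap_apply {N M : ℕ} (J : Finset (Fin M)) (x : Fin M → ℂ)
    (p : (Fin N → Fin M → ℂ) × (Fin N → ℂ)) :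
    splitMap J x p = (mask J p.1, fun i => (∑ k ∈ Jᶜ, x k * p.1 i k) + p.2 i) := rfl

/-- The columns in `J` are independent of the remaining part of the observation, which is white
Gaussian noise of variance `ν² + ∑_{k ∉ J} |x_k|²`. -/
theorem map_splitMap {N M : ℕ} (J : Finset (Fin M)) (x : Fin M → ℂ) (ν s : ℝ)
    (hs : s ^ 2 = ν ^ 2 + ∑ k ∈ Jᶜ, ‖x k‖ ^ 2) :
    ((gaussianMatrix N M).prod (noise N ν)).map (splitMap J x) =
      ((gaussianMatrix N M).prod (noise N s)).map (splitMap J 0) := by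
  have := Measure.isProbabilityMeasure_map (μ := (gaussianMatrix N M).prod (noise N ν))
    (splitMap J x).continuous.measurable.aemeasurable
  have := Measure.isProbabilityMeasure_map (μ := (gaussianMatrix N M).prod (noise N s))
    (splitMap J (0 : Fin M → ℂ)).continuous.measurable.aemeasurable
  refine Measure.ext_of_charFunDual (funext fun L => ?_)
  rw [charFunDual_map, charFunDual_map, charFunDual_prod, charFunDual_prod,
    charFunDual_gaussianMatrix, charFunDual_gaussianMatrix, charFunDual_noise, charFunDual_noise,
    ← Complex.exp_add, ← Complex.exp_add, ← Complex.ofReal_add, ← Complex.ofReal_add]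
  congr 2
  have hn : ∀ y : Fin M → ℂ, ∀ i, dualSq (((L.comp (splitMap J y)).comp
      (.inr ℝ (Fin N → Fin M → ℂ) (Fin N → ℂ))).comp (.single ℝ (fun _ => ℂ) i)) =
      dualSq ((L.comp (.inr ℝ (Fin N → Fin M → ℂ) (Fin N → ℂ))).comp
        (.single ℝ (fun _ => ℂ) i)) := fun y i => by
    congr 1
    ext z
    simp only [ContinuousLinearMap.comp_apply, splitMap_apply, ContinuousLinearMap.inr_apply]
    congr 2
    · ext; simp [mask]
    · ext; simp
  -- A column in `J` is seen only through the masked matrix, any other column only through the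
  -- observation, with weight `y k`.
  have hA : ∀ y : Fin M → ℂ, ∀ i k, dualSq ((((L.comp (splitMap J y)).comp
      (.inl ℝ (Fin N → Fin M → ℂ) (Fin N → ℂ))).comp (.single ℝ (fun _ => Fin M → ℂ) i)).comp
        (.single ℝ (fun _ => ℂ) k)) =
      if k ∈ J then dualSq (((L.comp (.inl ℝ (Fin N → Fin M → ℂ) (Fin N → ℂ))).comp
        (.single ℝ (fun _ => Fin M → ℂ) i)).comp (.single ℝ (fun _ => ℂ) k))
      else ‖y k‖ ^ 2 * dualSq ((L.comp (.inr ℝ (Fin N → Fin M → ℂ) (Fin N → ℂ))).comp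
        (.single ℝ (fun _ => ℂ) i)) := fun y i k => by
    split_ifs with hk
    · congr 1
      ext z
      simp only [ContinuousLinearMap.comp_apply, splitMap_apply, ContinuousLinearMap.inl_apply]
      congr 2
      · ext i' k'
        rcases eq_or_ne i' i with rfl | hi <;> rcases eq_or_ne k' k with rfl | hk' <;>
          simp [mask, *]
      · ext i'
        rcases eq_or_ne i' i with rfl | hi <;> simp [*]
        refine Finset.sum_eq_zero fun k' hk' => ?_
        have : k' ≠ k := by rintro rfl; simp [hk] at hk'
        simp [this]
    · refine dualSq_of_apply_eq_mul (y k) fun z => ?_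
      simp only [ContinuousLinearMap.comp_apply, splitMap_apply, ContinuousLinearMap.inl_apply,
        ContinuousLinearMap.inr_apply]
      congr 2
      · ext i' k'
        rcases eq_or_ne i' i with rfl | hi <;> rcases eq_or_ne k' k with rfl | hk' <;>
          simp [mask, *]
      · ext i'
        rcases eq_or_ne i' i with rfl | hi <;> simp [*]
        rw [Finset.sum_eq_single k] <;> simp +contextual [hk]
  simp only [hn, hA]
  -- The exponent depends on the signal and the noise level only through `t ^ 2 + ∑ k ∈ Jᶜ, ‖y k‖ ^
  -- 2`, which is `s ^ 2` for both `(x, ν)` and `(0, s)`.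
  have key : ∀ y : Fin M → ℂ, ∀ t : ℝ, t ^ 2 + ∑ k ∈ Jᶜ, ‖y k‖ ^ 2 = s ^ 2 →
      ∀ (a : Fin N → Fin M → ℝ) (b : Fin N → ℝ), -((∑ i, ∑ k, if k ∈ J then a i k else ‖y k‖ ^ 2 * b i) / 4) +
        -(t ^ 2 * (∑ i, b i) / 4) = -(∑ i, ∑ k ∈ J, a i k) / 4 - s ^ 2 * (∑ i, b i) / 4 := by
    intro y t ht a b
    have : ∀ i, (∑ k, if k ∈ J then a i k else ‖y k‖ ^ 2 * b i) =
        ∑ k ∈ J, a i k + (∑ k ∈ Jᶜ, ‖y k‖ ^ 2) * b i := fun i => by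
      rw [← Finset.sum_add_sum_compl J]
      congr 1
      · exact Finset.sum_congr rfl fun k hk => by simp [hk]
      · rw [Finset.sum_mul]
        exact Finset.sum_congr rfl fun k hk => by simp [Finset.mem_compl.1 hk]
    simp only [this, Finset.sum_add_distrib, ← Finset.mul_sum]
    rw [← ht]; ring
  rw [key x ν hs.symm, key 0 s (by simp)]

/-- The coordinates of white Gaussian noise with respect to an orthonormal family are again white
Gaussian noise. -/
theorem map_inner_noise {N d : ℕ} (b : Fin d → EuclideanSpace ℂ (Fin N)) (hb : Orthonormal ℂ b)
    (ν : ℝ) :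
    (noise N ν).map (fun z j => inner ℂ (b j) (WithLp.toLp 2 z)) = noise d ν := by
  let T : (Fin N → ℂ) →L[ℝ] (Fin d → ℂ) := LinearMap.toContinuousLinearMap
    { toFun := fun z j => inner ℂ (b j) (WithLp.toLp 2 z)
      map_add' := fun p q => by ext j; simp
      map_smul' := fun r p => by
        ext j
        simp [PiLp.inner_apply, Finset.mul_sum] }
  change (noise N ν).map T = _
  have := Measure.isProbabilityMeasure_map (μ := noise N ν) T.continuous.measurable.aemeasurable
  refine Measure.ext_of_charFunDual (funext fun L => ?_)
  rw [charFunDual_map, charFunDual_noise, charFunDual_noise]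
  congr 5
  -- `c` represents `L` as the real part of an inner product. The pulled-back functional is then
  -- represented by `∑ j, c j • b j`, which has the same norm as `c` by orthonormality.
  let c : Fin d → ℂ := fun j => ⟨L (Pi.single j 1), L (Pi.single j Complex.I)⟩
  have hL : ∀ w, L w = (∑ j, starRingEnd ℂ (c j) * w j).re := fun w => by
    conv_lhs => rw [← L.sum_comp_single]
    rw [Complex.re_sum]
    refine Finset.sum_congr rfl fun j _ => ?_
    rw [strongDual_complex_apply]
    simp [c]; ring
  have h1 : ∀ i, dualSq ((L.comp T).comp (.single ℝ (fun _ => ℂ) i)) =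
      ‖(∑ j, c j • b j) i‖ ^ 2 := fun i => by
    have hT : ∀ z j, T (Pi.single i z) j = starRingEnd ℂ (b j i) * z := fun z j => by
      change inner ℂ (b j) (WithLp.toLp 2 (Pi.single i z)) = _
      rw [PiLp.inner_apply, Finset.sum_eq_single i] <;> simp +contextual [mul_comm]
    have hz : ∀ z, L (T (Pi.single i z)) = (starRingEnd ℂ ((∑ j, c j • b j) i) * z).re :=
      fun z => by
        rw [hL]; simp only [hT]
        congr 1
        simp [Finset.sum_mul, mul_assoc]
    simp only [dualSq, ContinuousLinearMap.comp_apply, ContinuousLinearMap.single_apply, hz]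
    rw [← Complex.normSq_eq_norm_sq, Complex.normSq_apply]
    simp only [Complex.mul_re, Complex.conj_re, Complex.conj_im, Complex.one_re,
      Complex.one_im, Complex.I_re, Complex.I_im]
    ring
  have h2 : ∀ j, dualSq (L.comp (.single ℝ (fun _ => ℂ) j)) = ‖c j‖ ^ 2 := fun j => by
    rw [← Complex.normSq_eq_norm_sq, Complex.normSq_apply]
    simp [dualSq, c]; ring
  simp only [h1, h2]
  rw [← EuclideanSpace.norm_sq_eq, ← Complex.ofReal_inj, Complex.ofReal_pow]
  have := inner_self_eq_norm_sq_to_K (𝕜 := ℂ) (∑ j, c j • b j)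
  rw [hb.inner_sum] at this
  refine this.symm.trans ?_
  rw [Complex.ofReal_sum]
  exact Finset.sum_congr rfl fun j _ => by simpa using Complex.conj_mul' (c j)

/-! ### Exponential moments -/

theorem lintegral_exp_mul_sq_gaussianReal (v : ℝ≥0) (θ : ℝ) (h : θ * (2 * v) < 1) :
    ∫⁻ t, ENNReal.ofReal (Real.exp (θ * t ^ 2)) ∂(gaussianReal 0 v) =
      ENNReal.ofReal (√(1 - θ * (2 * v))⁻¹) := by
  rcases eq_or_ne v 0 with rfl | hv
  · rw [gaussianReal_zero_var, lintegral_dirac' _ (by fun_prop)]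
    simp
  have hv0 : (0 : ℝ) < v := by positivity
  have hb : 0 < 1 / (2 * v) - θ := by rw [sub_pos, lt_div_iff₀ (by positivity)]; exact h
  rw [gaussianReal_of_var_ne_zero _ hv, lintegral_withDensity_eq_lintegral_mul₀
    (by fun_prop) (by fun_prop)]
  have : ∀ t, (gaussianPDF 0 v * fun t => ENNReal.ofReal (Real.exp (θ * t ^ 2))) t =
      ENNReal.ofReal ((√(2 * Real.pi * v))⁻¹ * Real.exp (-(1 / (2 * v) - θ) * t ^ 2)) := fun t => by
    rw [Pi.mul_apply, gaussianPDF, ← ENNReal.ofReal_mul (gaussianPDFReal_nonneg _ _ _),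
      gaussianPDFReal, mul_assoc, ← Real.exp_add]
    congr 3
    field_simp
    ring
  simp_rw [this]
  rw [← ofReal_integral_eq_lintegral_ofReal ((integrable_exp_neg_mul_sq hb).const_mul _)
    (ae_of_all _ fun t => by positivity), integral_const_mul, integral_gaussian,
    ← Real.sqrt_inv, ← Real.sqrt_mul (by positivity)]
  congr 2
  have hb' : 1 / (2 * (v : ℝ)) - θ ≠ 0 := hb.ne'
  have h1 : 1 - θ * (2 * v) ≠ 0 := by linarith
  have := Real.pi_pos.ne'
  field_simp

theorem lintegral_exp_mul_norm_sq_complexGaussian (v : ℝ≥0) (θ : ℝ) (h : θ * v < 1) :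
    ∫⁻ z, ENNReal.ofReal (Real.exp (θ * ‖z‖ ^ 2)) ∂(complexGaussian v) =
      ENNReal.ofReal (1 - θ * v)⁻¹ := by
  have h2 : θ * (2 * ((v / 2 : ℝ≥0) : ℝ)) = θ * v := by push_cast; ring
  rw [complexGaussian, lintegral_map_equiv]
  have : ∀ p : ℝ × ℝ, ENNReal.ofReal
      (Real.exp (θ * ‖Complex.measurableEquivRealProd.symm p‖ ^ 2)) =
      ENNReal.ofReal (Real.exp (θ * p.1 ^ 2)) * ENNReal.ofReal (Real.exp (θ * p.2 ^ 2)) := by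
    intro p
    rw [← ENNReal.ofReal_mul (by positivity), ← Real.exp_add, ← Complex.normSq_eq_norm_sq,
      Complex.normSq_apply]
    congr 2
    simp [Complex.measurableEquivRealProd]
    ring
  simp_rw [this]
  rw [lintegral_prod_mul (f := fun t : ℝ => ENNReal.ofReal (Real.exp (θ * t ^ 2)))
      (g := fun t : ℝ => ENNReal.ofReal (Real.exp (θ * t ^ 2))) (by fun_prop) (by fun_prop),
    lintegral_exp_mul_sq_gaussianReal _ _ (by rw [h2]; exact h), h2,
    ← ENNReal.ofReal_mul (by positivity), Real.mul_self_sqrt]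
  rw [inv_nonneg]; linarith

theorem lintegral_exp_mul_sum_norm_sq_noise (d : ℕ) (ν θ : ℝ) (h : θ * ν ^ 2 < 1) :
    ∫⁻ z, ENNReal.ofReal (Real.exp (θ * ∑ j, ‖z j‖ ^ 2)) ∂(noise d ν) =
      ENNReal.ofReal (1 - θ * ν ^ 2)⁻¹ ^ d := by
  have hi : iIndepFun (fun j : Fin d => fun z : Fin d → ℂ =>
      ENNReal.ofReal (Real.exp (θ * ‖z j‖ ^ 2))) (noise d ν) := by
    rw [noise_eq_pi]
    exact iIndepFun_pi (X := fun _ (z : ℂ) => ENNReal.ofReal (Real.exp (θ * ‖z‖ ^ 2)))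
        (fun _ => by fun_prop)
  have hp : ∀ z : Fin d → ℂ, ENNReal.ofReal (Real.exp (θ * ∑ j, ‖z j‖ ^ 2)) =
      ∏ j, ENNReal.ofReal (Real.exp (θ * ‖z j‖ ^ 2)) := fun z => by
    rw [← ENNReal.ofReal_prod_of_nonneg (fun _ _ => by positivity), ← Real.exp_sum,
      Finset.mul_sum]
  simp_rw [hp]
  rw [lintegral_prod_eq_prod_lintegral_of_indepFun _ _ hi (fun _ => by fun_prop)]
  have : ∀ j : Fin d, ∫⁻ z, ENNReal.ofReal (Real.exp (θ * ‖z j‖ ^ 2)) ∂(noise d ν) =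
      ENNReal.ofReal (1 - θ * ν ^ 2)⁻¹ := fun j => by
    have hm := (measurePreserving_eval (fun _ : Fin d => complexGaussian (ν ^ 2).toNNReal) j)
    have := hm.lintegral_comp (f := fun z => ENNReal.ofReal (Real.exp (θ * ‖z‖ ^ 2)))
      (by fun_prop)
    have hv : ((ν ^ 2).toNNReal : ℝ) = ν ^ 2 := Real.coe_toNNReal _ (sq_nonneg ν)
    rw [noise_eq_pi]
    refine this.trans ?_
    rw [lintegral_exp_mul_norm_sq_complexGaussian _ _ (by rwa [hv]), hv]
  simp [this]

/-- Exponential moments of the squared norm of the projection of white Gaussian noise. -/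
theorem lintegral_exp_mul_norm_sq_starProjection {N : ℕ}
    (W : Submodule ℂ (EuclideanSpace ℂ (Fin N))) (ν θ : ℝ) (h : θ * ν ^ 2 < 1) :
    ∫⁻ z, ENNReal.ofReal (Real.exp (θ * ‖W.starProjection (WithLp.toLp 2 z)‖ ^ 2)) ∂(noise N ν) =
      ENNReal.ofReal (1 - θ * ν ^ 2)⁻¹ ^ Module.finrank ℂ W := by
  let b := stdOrthonormalBasis ℂ W
  have hb : Orthonormal ℂ (fun j => (b j : EuclideanSpace ℂ (Fin N))) :=
    b.orthonormal.comp_linearIsometry W.subtypeₗᵢ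
  have hq : ∀ z : Fin N → ℂ, ‖W.starProjection (WithLp.toLp 2 z)‖ ^ 2 =
      ∑ j, ‖inner ℂ (b j : EuclideanSpace ℂ (Fin N)) (WithLp.toLp 2 z)‖ ^ 2 := fun z => by
    rw [Submodule.starProjection_apply, ← Submodule.coe_norm, ← b.sum_sq_norm_inner_right]
    simp
  simp_rw [hq]
  rw [← lintegral_exp_mul_sum_norm_sq_noise _ _ _ h, ← map_inner_noise _ hb,
    lintegral_map (by fun_prop)]
  refine measurable_pi_lambda _ fun j => Continuous.measurable ?_
  fun_prop

/-! ### The residual energy -/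

/-- The energy of the projection of `y` onto the orthogonal complement of the columns in `J`. -/
def residual {N M : ℕ} (J : Finset (Fin M)) (A : Matrix (Fin N) (Fin M) ℂ) (y : Fin N → ℂ) : ℝ :=
  ‖(columnSpace A J)ᗮ.starProjection (WithLp.toLp 2 y)‖ ^ 2

theorem col_mem_columnSpace {N M : ℕ} (A : Matrix (Fin N) (Fin M) ℂ) {J : Finset (Fin M)}
    {j : Fin M} (hj : j ∈ J) : WithLp.toLp 2 (A.col j) ∈ columnSpace A J :=
  Submodule.subset_span ⟨⟨j, hj⟩, rfl⟩

theorem columnSpace_mask {N M : ℕ} (A : Fin N → Fin M → ℂ) (J : Finset (Fin M)) :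
    columnSpace (Matrix.of (mask J A)) J = columnSpace (Matrix.of A) J := by
  unfold columnSpace
  congr 2
  ext j i
  simp [columns, mask, Matrix.col]

theorem residual_congr {N M : ℕ} {J : Finset (Fin M)} {A B : Matrix (Fin N) (Fin M) ℂ}
    (h : columnSpace A J = columnSpace B J) (y : Fin N → ℂ) : residual J A y = residual J B y := by
  simp only [residual, h]

/-- The columns in `J` are annihilated by the projection, so the residual is a function of `splitMap
J x` alone and `map_splitMap` applies to it. -/
theorem residual_observation {N M : ℕ} (J : Finset (Fin M)) (x : Fin M → ℂ)
    (p : (Fin N → Fin M → ℂ) × (Fin N → ℂ)) :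
    residual J (Matrix.of p.1) (observation (Matrix.of p.1) x p.2) =
      residual J (Matrix.of (splitMap J x p).1) (splitMap J x p).2 := by
  rw [splitMap_apply, residual_congr (columnSpace_mask _ J), residual, residual]
  have h : WithLp.toLp 2 (observation (Matrix.of p.1) x p.2) =
      WithLp.toLp 2 (fun i => (∑ k ∈ Jᶜ, x k * p.1 i k) + p.2 i) +
        ∑ k ∈ J, x k • WithLp.toLp 2 ((Matrix.of p.1).col k) := by
    ext i
    simp only [observation, PiLp.add_apply, Pi.add_apply, Matrix.mulVec, dotProduct,
      ← Finset.sum_add_sum_compl J, WithLp.ofLp_sum, Finset.sum_apply, WithLp.ofLp_smul,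
      Pi.smul_apply, Matrix.col_apply, Matrix.of_apply, smul_eq_mul]
    simp only [mul_comm (p.1 i _)]
    ring
  have h0 : (columnSpace (Matrix.of p.1) J)ᗮ.starProjection
      (∑ k ∈ J, x k • WithLp.toLp 2 ((Matrix.of p.1).col k)) = 0 := by
    rw [Submodule.starProjection_apply_eq_zero_iff, Submodule.orthogonal_orthogonal]
    exact Submodule.sum_mem _ fun k hk => Submodule.smul_mem _ _ (col_mem_columnSpace _ hk)
  rw [h, map_add, h0, add_zero]

/-- The projection realizes the distance to the column space. This is the route to measurability:
the projection can jump in `A` where the rank drops, but strict sublevel sets of the distance are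
unions of open sets. -/
theorem norm_starProjection_lt_iff {N M : ℕ} (J : Finset (Fin M)) (A : Matrix (Fin N) (Fin M) ℂ)
    (y : Fin N → ℂ) (r : ℝ) :
    ‖(columnSpace A J)ᗮ.starProjection (WithLp.toLp 2 y)‖ < r ↔
      ∃ c : J → ℂ, ‖WithLp.toLp 2 y - ∑ j : J, c j • WithLp.toLp 2 (A.col j)‖ < r := by
  rw [Submodule.starProjection_orthogonal_val]
  constructor
  · intro h
    obtain ⟨c, hc⟩ := (Submodule.mem_span_range_iff_exists_fun ℂ).1
      ((columnSpace A J).starProjection_apply_mem (WithLp.toLp 2 y))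
    refine ⟨c, ?_⟩
    rw [← hc] at h
    exact h
  · rintro ⟨c, hc⟩
    refine lt_of_le_of_lt ?_ hc
    rw [Submodule.starProjection_minimal]
    exact ciInf_le ⟨0, by rintro _ ⟨v, rfl⟩; exact norm_nonneg _⟩
      (⟨_, Submodule.sum_mem _ fun j _ => Submodule.smul_mem _ _ (col_mem_columnSpace A j.2)⟩ :
        columnSpace A J)

theorem measurable_residual {N M : ℕ} (J : Finset (Fin M)) :
    Measurable fun p : (Fin N → Fin M → ℂ) × (Fin N → ℂ) => residual J (Matrix.of p.1) p.2 := by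
  refine Measurable.pow_const (measurable_of_Iio fun r => IsOpen.measurableSet ?_) 2
  have : (fun p : (Fin N → Fin M → ℂ) × (Fin N → ℂ) =>
      ‖(columnSpace (Matrix.of p.1) J)ᗮ.starProjection (WithLp.toLp 2 p.2)‖) ⁻¹' Set.Iio r =
      ⋃ c : J → ℂ, {p : (Fin N → Fin M → ℂ) × (Fin N → ℂ) | ‖WithLp.toLp 2 p.2 -
        ∑ j : J, c j • WithLp.toLp 2 ((Matrix.of p.1).col j)‖ < r} := by
    ext p
    rw [Set.mem_preimage, Set.mem_Iio, norm_starProjection_lt_iff, Set.mem_iUnion]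
    rfl
  rw [this]
  refine isOpen_iUnion fun c => isOpen_lt (Continuous.norm (Continuous.sub (by fun_prop) ?_))
    continuous_const
  refine continuous_finsetSum _ fun j _ => Continuous.fun_const_smul ?_ _
  refine (PiLp.continuous_toLp 2 _).comp (continuous_pi fun i => ?_)
  simp only [Matrix.col_apply, Matrix.of_apply]
  fun_prop

theorem measurable_observation {N M : ℕ} (x : Fin M → ℂ) :
    Measurable fun p : (Fin N → Fin M → ℂ) × (Fin N → ℂ) =>
      (p.1, observation (Matrix.of p.1) x p.2) := by
  refine measurable_fst.prodMk (Continuous.measurable (continuous_pi fun i => ?_))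
  simp only [observation, Pi.add_apply, Matrix.mulVec, dotProduct, Matrix.of_apply]
  fun_prop

theorem measurable_residual_observation {N M : ℕ} (J : Finset (Fin M)) (x : Fin M → ℂ) :
    Measurable fun p : (Fin N → Fin M → ℂ) × (Fin N → ℂ) =>
      residual J (Matrix.of p.1) (observation (Matrix.of p.1) x p.2) := by
  have h := (measurable_residual (N := N) J).comp (measurable_observation x)
  simpa only [Function.comp_def] using h

/-- With the trivial upper bound `N`, this bound controls both signs of the exponent for every `A`,
so the moment bounds do not need the rank of `A_J`. -/
theorem le_finrank_columnSpace_orthogonal {N M : ℕ} (A : Matrix (Fin N) (Fin M) ℂ)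
    (J : Finset (Fin M)) : N - J.card ≤ Module.finrank ℂ (columnSpace A J)ᗮ := by
  have h1 := (columnSpace A J).finrank_add_finrank_orthogonal
  have h2 : Module.finrank ℂ (columnSpace A J) ≤ J.card := by
    refine (finrank_range_le_card (R := ℂ)
      (fun j : J => WithLp.toLp 2 ((columns A J).col j))).trans_eq (Fintype.card_coe J)
  simp only [finrank_euclideanSpace, Fintype.card_fin] at h1
  omega

theorem finrank_columnSpace_orthogonal_le {N M : ℕ} (A : Matrix (Fin N) (Fin M) ℂ)
    (J : Finset (Fin M)) : Module.finrank ℂ (columnSpace A J)ᗮ ≤ N := by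
  simpa using (columnSpace A J)ᗮ.finrank_le

/-! ### Exponential moments of the residual energy -/

/-- Exchanging laws by `map_splitMap` replaces the observation by noise of level `s` independent of
the matrix; for fixed `A` the inner integral is the moment of noise projected onto a fixed subspace.
-/
theorem lintegral_exp_mul_residual {N M : ℕ} (J : Finset (Fin M)) (x : Fin M → ℂ) (ν s θ : ℝ)
    (hs : s ^ 2 = ν ^ 2 + ∑ k ∈ Jᶜ, ‖x k‖ ^ 2) (hθ : θ * s ^ 2 < 1) :
    ∫⁻ A, ∫⁻ n, ENNReal.ofReal (Real.exp (θ * residual J (Matrix.of A)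
        (observation (Matrix.of A) x n))) ∂(noise N ν) ∂(gaussianMatrix N M) =
      ∫⁻ A, ENNReal.ofReal (1 - θ * s ^ 2)⁻¹ ^
        Module.finrank ℂ (columnSpace (Matrix.of A) J)ᗮ ∂(gaussianMatrix N M) := by
  have hm : Measurable fun p : (Fin N → Fin M → ℂ) × (Fin N → ℂ) =>
      ENNReal.ofReal (Real.exp (θ * residual J (Matrix.of p.1) p.2)) :=
    ((measurable_residual J).const_mul θ).exp.ennreal_ofReal
  have hms : ∀ y : Fin M → ℂ, Measurable (splitMap (N := N) J y) :=
    fun y => (splitMap J y).continuous.measurable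
  rw [← lintegral_prod (fun p : (Fin N → Fin M → ℂ) × (Fin N → ℂ) =>
    ENNReal.ofReal (Real.exp (θ * residual J (Matrix.of p.1) (observation (Matrix.of p.1) x p.2))))
    (((measurable_residual_observation J x).const_mul θ).exp.ennreal_ofReal).aemeasurable]
  simp_rw [residual_observation]
  rw [← lintegral_map hm (hms x), map_splitMap J x ν s hs, lintegral_map hm (hms 0),
    lintegral_prod _ (by simpa only [Function.comp_def] using (hm.comp (hms 0)).aemeasurable)]
  refine lintegral_congr fun A => ?_
  rw [← lintegral_exp_mul_norm_sq_starProjection _ s θ hθ]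
  refine lintegral_congr fun z => ?_
  rw [splitMap_apply, residual_congr (columnSpace_mask _ J), residual]
  simp

theorem lintegral_exp_mul_residual_le_of_nonpos {N M : ℕ} (J : Finset (Fin M)) (x : Fin M → ℂ)
    (ν s θ : ℝ) (hs : s ^ 2 = ν ^ 2 + ∑ k ∈ Jᶜ, ‖x k‖ ^ 2) (hθ : θ ≤ 0) :
    ∫⁻ A, ∫⁻ n, ENNReal.ofReal (Real.exp (θ * residual J (Matrix.of A)
        (observation (Matrix.of A) x n))) ∂(noise N ν) ∂(gaussianMatrix N M) ≤
      ENNReal.ofReal (1 - θ * s ^ 2)⁻¹ ^ (N - J.card) := by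
  have h1 : θ * s ^ 2 ≤ 0 := mul_nonpos_of_nonpos_of_nonneg hθ (sq_nonneg s)
  rw [lintegral_exp_mul_residual J x ν s θ hs (h1.trans_lt one_pos)]
  calc _ ≤ ∫⁻ _, ENNReal.ofReal (1 - θ * s ^ 2)⁻¹ ^ (N - J.card) ∂(gaussianMatrix N M) := by
        refine lintegral_mono fun A => pow_le_pow_right_of_le_one' ?_
          (le_finrank_columnSpace_orthogonal _ J)
        exact ENNReal.ofReal_le_one.2 (inv_le_one_of_one_le₀ (by linarith))
    _ = _ := by simp

theorem lintegral_exp_mul_residual_le_of_nonneg {N M : ℕ} (J : Finset (Fin M)) (x : Fin M → ℂ)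
    (ν s θ : ℝ) (hs : s ^ 2 = ν ^ 2 + ∑ k ∈ Jᶜ, ‖x k‖ ^ 2) (hθ : 0 ≤ θ) (h : θ * s ^ 2 < 1) :
    ∫⁻ A, ∫⁻ n, ENNReal.ofReal (Real.exp (θ * residual J (Matrix.of A)
        (observation (Matrix.of A) x n))) ∂(noise N ν) ∂(gaussianMatrix N M) ≤
      ENNReal.ofReal (1 - θ * s ^ 2)⁻¹ ^ N := by
  have h1 : 0 ≤ θ * s ^ 2 := mul_nonneg hθ (sq_nonneg s)
  rw [lintegral_exp_mul_residual J x ν s θ hs h]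
  calc _ ≤ ∫⁻ _, ENNReal.ofReal (1 - θ * s ^ 2)⁻¹ ^ N ∂(gaussianMatrix N M) := by
        refine lintegral_mono fun A => pow_le_pow_right₀ ?_
          (finrank_columnSpace_orthogonal_le _ J)
        exact ENNReal.one_le_ofReal.2 ((one_le_inv₀ (by linarith)).2 (by linarith))
    _ = _ := by simp

/-! ### Gaussian matrices have full column rank -/

theorem noise_zero (N : ℕ) : noise N 0 = Measure.dirac 0 := by
  refine Measure.ext_of_charFunDual (funext fun L => ?_)
  simp [charFunDual_noise]

/-- With signal `e_j` and no noise, the observation is column `j` itself, and membership in the span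
means zero residual. The moment bound at `-t` gives such an event probability at most `1 / (1 + t)`,
for every `t`. -/
theorem ae_col_notMem_columnSpace {N M : ℕ} (J : Finset (Fin M)) (j : Fin M) (hj : j ∉ J)
    (hJ : J.card < N) :
    ∀ᵐ A ∂(gaussianMatrix N M),
      WithLp.toLp 2 ((Matrix.of A).col j) ∉ columnSpace (Matrix.of A) J := by
  have hbound : ∀ t : ℕ, gaussianMatrix N M
      {A | WithLp.toLp 2 ((Matrix.of A).col j) ∈ columnSpace (Matrix.of A) J} ≤
      ENNReal.ofReal (1 + (t : ℝ))⁻¹ := fun t => by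
    have hm : Measurable fun p : (Fin N → Fin M → ℂ) × (Fin N → ℂ) =>
        ENNReal.ofReal (Real.exp (-(t : ℝ) * residual J (Matrix.of p.1)
          (observation (Matrix.of p.1) (Pi.single j 1) p.2))) :=
      ((measurable_residual_observation J _).const_mul _).exp.ennreal_ofReal
    have hs : (1 : ℝ) ^ 2 = 0 ^ 2 + ∑ k ∈ Jᶜ, ‖(Pi.single j 1 : Fin M → ℂ) k‖ ^ 2 := by
      rw [Finset.sum_eq_single_of_mem j (Finset.mem_compl.2 hj) fun k _ hk => by simp [hk]]
      simp
    have h := lintegral_exp_mul_residual_le_of_nonpos (N := N) J (Pi.single j 1) 0 1 (-(t : ℝ)) hs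
      (neg_nonpos.2 t.cast_nonneg)
    refine (meas_le_lintegral₀ hm.lintegral_prod_right'.aemeasurable fun A hA => ?_).trans
      (h.trans ?_)
    · rw [noise_zero, lintegral_dirac' _ (by
        simpa only [Function.comp_def] using hm.comp (measurable_prodMk_left (x := A)))]
      have : residual J (Matrix.of A) (observation (Matrix.of A) (Pi.single j 1) 0) = 0 := by
        rw [residual, observation, add_zero, Matrix.mulVec_single_one,
          (Submodule.starProjection_apply_eq_zero_iff _).2
            (by rw [Submodule.orthogonal_orthogonal]; exact hA)]
        simp
      simp [this]
    · have h1 : ENNReal.ofReal (1 - -(t : ℝ) * 1 ^ 2)⁻¹ ≤ 1 :=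
        ENNReal.ofReal_le_one.2 (inv_le_one_of_one_le₀ (by
          have : (0 : ℝ) ≤ t := t.cast_nonneg
          linarith))
      -- The exponent `N - J.card` is at least one; a single factor already tends to zero.
      refine ((pow_le_pow_right_of_le_one' h1 (Nat.sub_pos_of_lt hJ)).trans_eq
        (pow_one _)).trans (le_of_eq ?_)
      congr 2; ring
  simp only [ae_iff, not_not]
  refine le_antisymm (ge_of_tendsto' (x := atTop) ?_ hbound) zero_le
  have : Tendsto (fun t : ℕ => (1 + (t : ℝ))⁻¹) atTop (𝓝 0) :=
    tendsto_inv_atTop_zero.comp (tendsto_atTop_add_const_left _ _ tendsto_natCast_atTop_atTop)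
  simpa using ENNReal.tendsto_ofReal this

theorem ae_rank_columns {N M : ℕ} (J : Finset (Fin M)) (hJ : J.card ≤ N) :
    ∀ᵐ A ∂(gaussianMatrix N M), (columns (Matrix.of A) J).rank = J.card := by
  have h : ∀ᵐ A ∂(gaussianMatrix N M), ∀ j : J,
      WithLp.toLp 2 ((Matrix.of A).col j) ∉ columnSpace (Matrix.of A) (J.erase j) := by
    refine ae_all_iff.2 fun j => ae_col_notMem_columnSpace _ _ (Finset.notMem_erase _ _) ?_
    exact (Finset.card_erase_lt_of_mem j.2).trans_le hJ
  filter_upwards [h] with A hA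
  have hli : LinearIndependent ℂ (fun j : J =>
      WithLp.toLp 2 ((columns (Matrix.of A) J).col j)) := by
    refine linearIndependent_iff_notMem_span.2 fun j hj => hA j ?_
    refine Submodule.span_mono ?_ hj
    rintro _ ⟨k, hk, rfl⟩
    have hk' : (k : Fin M) ≠ j := fun h => hk.2 (Subtype.ext h)
    exact ⟨⟨k, Finset.mem_erase.2 ⟨hk', k.2⟩⟩, rfl⟩
  have hli' : LinearIndependent ℂ (columns (Matrix.of A) J).col :=
    LinearIndependent.of_comp (WithLp.linearEquiv 2 ℂ (Fin N → ℂ)).symm.toLinearMap hli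
  rw [Matrix.rank_eq_finrank_span_cols, finrank_span_eq_card hli', Fintype.card_coe]

/-! ### The union bound -/

/-- The exponential moment of the residual energy, for a fixed measurement matrix. -/
def expMoment {N M : ℕ} (ν θ : ℝ) (x : Fin M → ℂ) (J : Finset (Fin M))
    (A : Fin N → Fin M → ℂ) : ℝ≥0∞ :=
  ∫⁻ n, ENNReal.ofReal (Real.exp (θ * residual J (Matrix.of A)
    (observation (Matrix.of A) x n))) ∂(noise N ν)

theorem measurable_expMoment {N M : ℕ} (ν θ : ℝ) (x : Fin M → ℂ) (J : Finset (Fin M)) :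
    Measurable (expMoment (N := N) ν θ x J) :=
  Measurable.lintegral_prod_right' (f := fun p : (Fin N → Fin M → ℂ) × (Fin N → ℂ) =>
    ENNReal.ofReal (Real.exp (θ * residual J (Matrix.of p.1) (observation (Matrix.of p.1) x p.2))))
    ((measurable_residual_observation J x).const_mul θ).exp.ennreal_ofReal

/-- Chernoff's bound for the residual energy. -/
theorem noise_le_expMoment {N M : ℕ} (ν θ τ : ℝ) (x : Fin M → ℂ) (J : Finset (Fin M))
    (A : Fin N → Fin M → ℂ) :
    noise N ν {n | θ * τ ≤ θ * residual J (Matrix.of A) (observation (Matrix.of A) x n)} ≤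
      ENNReal.ofReal (Real.exp (-(θ * τ))) * expMoment ν θ x J A := by
  have hm : Measurable fun n : Fin N → ℂ => ENNReal.ofReal (Real.exp (θ * residual J (Matrix.of A)
      (observation (Matrix.of A) x n))) := by
    have h := (((measurable_residual_observation (N := N) J x).const_mul
      θ).exp.ennreal_ofReal).comp (measurable_prodMk_left (x := A))
    simpa only [Function.comp_def] using h
  rw [expMoment, ← lintegral_const_mul _ hm]
  refine meas_le_lintegral₀ (hm.const_mul _).aemeasurable fun n hn => ?_
  rw [← ENNReal.ofReal_mul (by positivity), ← Real.exp_add]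
  refine ENNReal.one_le_ofReal.2 (Real.one_le_exp ?_)
  have := Set.mem_ofPred_eq ▸ hn
  linarith

open Classical in
/-- The index sets of size `L` that carry too little of the energy of `x`. -/
def wrongSets {M : ℕ} (γ : ℝ) (L : ℕ) (x : Fin M → ℂ) : Finset (Finset (Fin M)) :=
  (Finset.univ.powersetCard L).filter fun J => ¬ EnergyRecovered γ x J

theorem mem_wrongSets {M : ℕ} {γ : ℝ} {L : ℕ} {x : Fin M → ℂ} {J : Finset (Fin M)} :
    J ∈ wrongSets γ L x ↔ J.card = L ∧ ¬ EnergyRecovered γ x J := by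
  simp [wrongSets]

theorem card_wrongSets_le {M : ℕ} (γ : ℝ) (L : ℕ) (x : Fin M → ℂ) :
    (wrongSets γ L x).card ≤ M ^ L := by
  classical
  refine (Finset.card_filter_le _ _).trans ?_
  rw [Finset.card_powersetCard, Finset.card_univ, Fintype.card_fin]
  exact Nat.choose_le_pow M L

theorem JointlyTypical.residual_lt {N M : ℕ} {δ ν : ℝ} {L : ℕ} {A : Matrix (Fin N) (Fin M) ℂ}
    {y : Fin N → ℂ} {J : Finset (Fin M)} (h : JointlyTypical δ ν L A y J) (hN : 0 < N) :
    residual J A y < (N - L) * ν ^ 2 + N * δ := by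
  have h1 := (abs_lt.1 h.2.2).2
  have hN' : (0 : ℝ) < N := Nat.cast_pos.2 hN
  change 1 / (N : ℝ) * residual J A y - _ < δ at h1
  have h2 : residual J A y - (N - L) * ν ^ 2 =
      N * (1 / (N : ℝ) * residual J A y - ((N : ℝ) - L) / N * ν ^ 2) := by field_simp
  nlinarith

theorem jointlyTypical_of_lt {N M : ℕ} {δ ν : ℝ} {A : Matrix (Fin N) (Fin M) ℂ}
    {y : Fin N → ℂ} {J : Finset (Fin M)} (hN : 0 < N) (hr : (columns A J).rank = J.card)
    (h1 : (N - J.card) * ν ^ 2 - N * δ < residual J A y)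
    (h2 : residual J A y < (N - J.card) * ν ^ 2 + N * δ) :
    JointlyTypical δ ν J.card A y J := by
  refine ⟨rfl, hr, ?_⟩
  have hN' : (0 : ℝ) < N := Nat.cast_pos.2 hN
  change |1 / (N : ℝ) * residual J A y - _| < δ
  have h3 : 1 / (N : ℝ) * residual J A y - ((N : ℝ) - J.card) / N * ν ^ 2 =
      (residual J A y - (N - J.card) * ν ^ 2) / N := by field_simp
  rw [h3, abs_lt, lt_div_iff₀ hN', div_lt_iff₀ hN']
  constructor <;> linarith

/-- If the residual at `supp x` lies in the window, the typical family is non-empty, so the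
decoder's output is typical and an error makes it a wrong set. The union over all wrong sets makes
the bound independent of the tie-breaking rule. -/
theorem pErrGiven_le {N M : ℕ} {γ ν δ : ℝ} {x : Fin M → ℂ}
    {sel : Finset (Finset (Fin M)) → Finset (Fin M)} (hsel : IsTieBreaking sel) (hN : 0 < N)
    {A : Fin N → Fin M → ℂ} (hA : (columns (Matrix.of A) (supp x)).rank = (supp x).card)
    {L : ℕ} (hL : (supp x).card = L) {θ lam : ℝ} (hθ : 0 ≤ θ) (hlam : 0 ≤ lam) :
    pErrGiven γ ν (typicalityDecoder δ ν L sel) x (Matrix.of A) ≤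
      ENNReal.ofReal (Real.exp (θ * ((N - L) * ν ^ 2 - N * δ))) * expMoment ν (-θ) x (supp x) A +
      ENNReal.ofReal (Real.exp (-(θ * ((N - L) * ν ^ 2 + N * δ)))) * expMoment ν θ x (supp x) A +
      ∑ J ∈ wrongSets γ L x,
        ENNReal.ofReal (Real.exp (lam * ((N - L) * ν ^ 2 + N * δ))) *
          expMoment ν (-lam) x J A := by
  subst hL
  set y : (Fin N → ℂ) → Fin N → ℂ := fun n => observation (Matrix.of A) x n
  set τ₁ : ℝ := (N - (supp x).card) * ν ^ 2 - N * δ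
  set τ₂ : ℝ := (N - (supp x).card) * ν ^ 2 + N * δ
  have hsub : {n | ¬ EnergyRecovered γ x
        (typicalityDecoder δ ν (supp x).card sel (Matrix.of A) (y n))} ⊆
      ({n | -θ * τ₁ ≤ -θ * residual (supp x) (Matrix.of A) (y n)} ∪
        {n | θ * τ₂ ≤ θ * residual (supp x) (Matrix.of A) (y n)}) ∪
      ⋃ J ∈ wrongSets γ (supp x).card x,
        {n | -lam * τ₂ ≤ -lam * residual J (Matrix.of A) (y n)} := by
    intro n hn
    rcases le_or_gt (residual (supp x) (Matrix.of A) (y n)) τ₁ with h1 | h1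
    · exact Or.inl (Or.inl (mul_le_mul_of_nonpos_left h1 (neg_nonpos.2 hθ)))
    rcases le_or_gt τ₂ (residual (supp x) (Matrix.of A) (y n)) with h2 | h2
    · exact Or.inl (Or.inr (mul_le_mul_of_nonneg_left h2 hθ))
    right
    have htyp := jointlyTypical_of_lt hN hA h1 h2
    have hmem : typicalityDecoder δ ν (supp x).card sel (Matrix.of A) (y n) ∈
        typicalSets δ ν (supp x).card (Matrix.of A) (y n) :=
      hsel _ ⟨supp x, by simpa [typicalSets] using htyp⟩
    have hJ : JointlyTypical δ ν (supp x).card (Matrix.of A) (y n)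
        (typicalityDecoder δ ν (supp x).card sel (Matrix.of A) (y n)) := by
      simpa [typicalSets] using hmem
    refine Set.mem_biUnion (mem_wrongSets.2 ⟨hJ.1, hn⟩) ?_
    exact mul_le_mul_of_nonpos_left (hJ.residual_lt hN).le (neg_nonpos.2 hlam)
  have e : ∀ a b : ℝ, -(-a * b) = a * b := fun a b => by ring
  refine (measure_mono hsub).trans ((measure_union_le _ _).trans (add_le_add
    ((measure_union_le _ _).trans (add_le_add ?_ ?_))
    ((measure_biUnion_finset_le _ _).trans (Finset.sum_le_sum fun J _ => ?_))))
  · simpa only [e] using noise_le_expMoment ν (-θ) τ₁ x (supp x) A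
  · exact noise_le_expMoment ν θ τ₂ x (supp x) A
  · simpa only [e] using noise_le_expMoment ν (-lam) τ₂ x J A

/-- The rank condition holds almost surely since `L ≤ N`. The error event itself need not be
measurable: only the dominating moments are. -/
theorem pErr_le {N M : ℕ} {γ ν δ : ℝ} {x : Fin M → ℂ}
    {sel : Finset (Finset (Fin M)) → Finset (Fin M)} (hsel : IsTieBreaking sel) (hN : 0 < N)
    {L : ℕ} (hL : (supp x).card = L) (hLN : L ≤ N) {θ lam : ℝ} (hθ : 0 ≤ θ) (hlam : 0 ≤ lam) :
    pErr (N := N) γ ν (typicalityDecoder δ ν L sel) x ≤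
      ENNReal.ofReal (Real.exp (θ * ((N - L) * ν ^ 2 - N * δ))) *
        ∫⁻ A, expMoment ν (-θ) x (supp x) A ∂(gaussianMatrix N M) +
      ENNReal.ofReal (Real.exp (-(θ * ((N - L) * ν ^ 2 + N * δ)))) *
        ∫⁻ A, expMoment ν θ x (supp x) A ∂(gaussianMatrix N M) +
      ∑ J ∈ wrongSets γ L x,
        ENNReal.ofReal (Real.exp (lam * ((N - L) * ν ^ 2 + N * δ))) *
          ∫⁻ A, expMoment ν (-lam) x J A ∂(gaussianMatrix N M) := by
  have hm := fun θ J => measurable_expMoment (N := N) ν θ x J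
  refine (lintegral_mono_ae ((ae_rank_columns (supp x) (hL.trans_le hLN)).mono fun A hA =>
    pErrGiven_le hsel hN hA hL hθ hlam)).trans (le_of_eq ?_)
  rw [lintegral_add_right _ (Finset.measurable_fun_sum _ fun J _ => (hm _ J).const_mul _),
    lintegral_add_left ((hm _ _).const_mul _),
    lintegral_finsetSum _ fun J _ => (hm _ J).const_mul _,
    lintegral_const_mul _ (hm _ _), lintegral_const_mul _ (hm _ _)]
  simp_rw [lintegral_const_mul _ (hm _ _)]

/-! ### Numerical estimates -/

theorem inv_le_exp_inv_sub_one (t : ℝ) : t⁻¹ ≤ Real.exp (t⁻¹ - 1) := by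
  simpa using Real.add_one_le_exp (t⁻¹ - 1)

theorem inv_one_add_le_exp {u : ℝ} (hu : 0 ≤ u) : (1 + u)⁻¹ ≤ Real.exp (-(u - u ^ 2)) := by
  refine (inv_le_exp_inv_sub_one _).trans (Real.exp_le_exp.2 ?_)
  rw [sub_le_iff_le_add, inv_le_iff_one_le_mul₀ (by linarith)]
  nlinarith [pow_nonneg hu 3]

theorem inv_one_sub_le_exp {u : ℝ} (hu : u ≤ 1 / 2) :
    (1 - u)⁻¹ ≤ Real.exp (u + 2 * u ^ 2) := by
  refine (inv_le_exp_inv_sub_one _).trans (Real.exp_le_exp.2 ?_)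
  rw [sub_le_iff_le_add, inv_le_iff_one_le_mul₀ (by linarith)]
  nlinarith [mul_nonneg (sq_nonneg u) (sub_nonneg.2 hu)]

theorem exp_mul_pow_le {a b r c : ℝ} {k : ℕ} (hr : 0 ≤ r) (h : r ≤ Real.exp b)
    (hc : a + k * b ≤ c) :
    ENNReal.ofReal (Real.exp a) * ENNReal.ofReal r ^ k ≤ ENNReal.ofReal (Real.exp c) := by
  rw [← ENNReal.ofReal_pow hr, ← ENNReal.ofReal_mul (Real.exp_pos a).le]
  refine ENNReal.ofReal_le_ofReal ?_
  calc Real.exp a * r ^ k ≤ Real.exp a * Real.exp b ^ k := by gcongr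
    _ = Real.exp (a + k * b) := by rw [← Real.exp_nat_mul, ← Real.exp_add]
    _ ≤ _ := Real.exp_le_exp.2 hc

theorem sum_compl_supp {M : ℕ} (x : Fin M → ℂ) : ∑ k ∈ (supp x)ᶜ, ‖x k‖ ^ 2 = 0 :=
  Finset.sum_eq_zero fun k hk => by
    have : x k = 0 := by simpa [supp] using hk
    simp [this]

/-- The only use of the error metric: every wrong set leaves excess power at least `γ * power x`,
however much it overlaps the support. -/
theorem le_sum_compl_of_mem_wrongSets {M : ℕ} {γ : ℝ} {L : ℕ} {x : Fin M → ℂ}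
    {J : Finset (Fin M)} (hJ : J ∈ wrongSets γ L x) :
    γ * power x ≤ ∑ k ∈ Jᶜ, ‖x k‖ ^ 2 := by
  have h1 : ∑ k ∈ J ∩ supp x, ‖x k‖ ^ 2 ≤ (1 - γ) * power x :=
    not_lt.1 (mem_wrongSets.1 hJ).2
  have h2 : ∑ k ∈ J ∩ supp x, ‖x k‖ ^ 2 = ∑ k ∈ J, ‖x k‖ ^ 2 := by
    refine Finset.sum_subset Finset.inter_subset_left fun k hk hk' => ?_
    have : x k = 0 := by
      by_contra h
      exact hk' (Finset.mem_inter.2 ⟨hk, by simpa [supp] using h⟩)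
    simp [this]
  have h3 : power x = ∑ k ∈ J, ‖x k‖ ^ 2 + ∑ k ∈ Jᶜ, ‖x k‖ ^ 2 :=
    (Finset.sum_add_sum_compl J _).symm
  linarith

/-- A non-asymptotic bound on the error probability of the joint-typicality decoder. -/
theorem pErr_le_exp {N M : ℕ} {γ ν δ : ℝ} {x : Fin M → ℂ}
    {sel : Finset (Finset (Fin M)) → Finset (Fin M)} (hsel : IsTieBreaking sel) (hN : 0 < N)
    {L : ℕ} (hL : (supp x).card = L) (hLN : 2 * L ≤ N) (hLδ : 4 * L * ν ^ 2 ≤ N * δ)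
    {θ lam m : ℝ} (hθ : 0 ≤ θ) (hlam : 0 ≤ lam) (hθ₁ : θ * ν ^ 2 ≤ 1 / 2)
    (hθ₂ : 4 * (θ * ν ^ 4) ≤ δ) (hm : ν ^ 2 + 4 * δ ≤ m)
    (hlm : lam * m ≤ 1) (hlm' : m ≤ (ν ^ 2 + γ * power x) * (1 - lam * m)) :
    pErr (N := N) γ ν (typicalityDecoder δ ν L sel) x ≤
      ENNReal.ofReal (Real.exp (-(θ * δ / 4) * N)) + ENNReal.ofReal (Real.exp (-(θ * δ / 4) * N)) +
        (M : ℝ≥0∞) ^ L * ENNReal.ofReal (Real.exp (-(lam * δ) * N)) := by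
  have hLN' : L ≤ N := by omega
  have hcast : ((N - L : ℕ) : ℝ) = N - L := Nat.cast_sub hLN'
  have hN' : (0 : ℝ) < N := Nat.cast_pos.2 hN
  have hL' : (0 : ℝ) ≤ L := L.cast_nonneg
  have hLN2 : 2 * (L : ℝ) ≤ N := by exact_mod_cast hLN
  have hu : 0 ≤ θ * ν ^ 2 := by positivity
  have hδ : 0 ≤ δ := le_trans (by positivity) hθ₂
  have hu2 : 4 * (θ * ν ^ 2) ^ 2 ≤ θ * δ := by
    have := mul_le_mul_of_nonneg_left hθ₂ hθ
    linarith
  have hνs : ν ^ 2 = ν ^ 2 + ∑ k ∈ (supp x)ᶜ, ‖x k‖ ^ 2 := by rw [sum_compl_supp, add_zero]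
  refine (pErr_le hsel hN hL hLN' hθ hlam).trans (add_le_add (add_le_add ?_ ?_) ?_)
  · refine (mul_le_mul_right (lintegral_exp_mul_residual_le_of_nonpos (supp x) x ν ν (-θ) hνs
      (neg_nonpos.2 hθ)) _).trans ?_
    rw [hL]
    have e : 1 - -θ * ν ^ 2 = 1 + θ * ν ^ 2 := by ring
    rw [e]
    refine exp_mul_pow_le (inv_nonneg.2 (by linarith)) (inv_one_add_le_exp hu) ?_
    rw [hcast]
    have h1 : (N - L) * (θ * ν ^ 2) ^ 2 ≤ N * (θ * ν ^ 2) ^ 2 := by gcongr; linarith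
    have h2 := mul_le_mul_of_nonneg_left hu2 hN'.le
    have h3 : 0 ≤ N * (θ * δ) := by positivity
    linarith
  -- Out of the gain `θδN`, using dimension `N` instead of `N - L` costs at most `θδN / 4` and the
  -- quadratic term at most `θδN / 2`; hence the rate `θδ / 4`.
  · refine (mul_le_mul_right (lintegral_exp_mul_residual_le_of_nonneg (supp x) x ν ν θ hνs hθ
      (by linarith)) _).trans ?_
    refine exp_mul_pow_le (inv_nonneg.2 (by linarith)) (inv_one_sub_le_exp hθ₁) ?_
    have h1 := mul_le_mul_of_nonneg_left hLδ hθ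
    have h2 := mul_le_mul_of_nonneg_left hu2 hN'.le
    linarith
  · have hJ : ∀ J ∈ wrongSets γ L x,
        ENNReal.ofReal (Real.exp (lam * ((N - L) * ν ^ 2 + N * δ))) *
          ∫⁻ A, expMoment ν (-lam) x J A ∂(gaussianMatrix N M) ≤
        ENNReal.ofReal (Real.exp (-(lam * δ) * N)) := fun J hJ => by
      have hcard : J.card = L := (mem_wrongSets.1 hJ).1
      have hle := le_sum_compl_of_mem_wrongSets hJ
      set t := ν ^ 2 + ∑ k ∈ Jᶜ, ‖x k‖ ^ 2 with ht
      have ht0 : 0 ≤ t := by positivity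
      have hs : √t ^ 2 = t := Real.sq_sqrt ht0
      refine (mul_le_mul_right (lintegral_exp_mul_residual_le_of_nonpos J x ν (√t) (-lam)
        (hs.trans ht) (neg_nonpos.2 hlam)) _).trans ?_
      have e : 1 - -lam * √t ^ 2 = 1 + lam * t := by rw [hs]; ring
      rw [e, hcard]
      have hlt : 0 ≤ lam * t := mul_nonneg hlam ht0
      have hmt : m ≤ t * (1 - lam * m) :=
        hlm'.trans (mul_le_mul_of_nonneg_right (by linarith) (by linarith))
      -- This is `log (1 + u) ≥ u / (1 + u)` at `u = lam * t`; the right side is at least `lam * m`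
      -- by `hmt`.
      have hinv : (1 + lam * t)⁻¹ ≤ Real.exp (-(lam * m)) := by
        refine (inv_le_exp_inv_sub_one _).trans (Real.exp_le_exp.2 ?_)
        rw [sub_le_iff_le_add, inv_le_iff_one_le_mul₀ (by linarith)]
        have := mul_le_mul_of_nonneg_left hmt hlam
        nlinarith
      refine exp_mul_pow_le (inv_nonneg.2 (by linarith)) hinv ?_
      rw [hcast]
      -- The margin `4δ(N - L) ≥ 2δN` beats the tolerance `δN` and leaves `δN`.
      have h1 : lam * (N - L) * (ν ^ 2 + 4 * δ) ≤ lam * (N - L) * m :=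
        mul_le_mul_of_nonneg_left hm (mul_nonneg hlam (by linarith))
      have h2 : 0 ≤ lam * δ * (N - 2 * L) := mul_nonneg (by positivity) (by linarith)
      linarith
    refine (Finset.sum_le_card_nsmul _ _ _ hJ).trans ?_
    rw [nsmul_eq_mul]
    gcongr
    exact_mod_cast card_wrongSets_le γ L x

/-! ### Asymptotics -/

/-- From `L ≤ M / 2` and `M ≥ 4` one gets `(M - L) ^ 2 ≥ M ^ 2 / 4 ≥ M`. -/
theorem eventually_log_le {L : ℕ → ℕ}
    (hL : (fun M => (L M : ℝ)) =o[atTop] (fun M => (M : ℝ))) :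
    ∀ᶠ M : ℕ in atTop, Real.log M ≤ 2 * Real.log ((M : ℝ) - L M) := by
  filter_upwards [hL.bound (show (0 : ℝ) < 1 / 2 by norm_num), eventually_ge_atTop 4] with M h hM
  have hM' : (4 : ℝ) ≤ M := by exact_mod_cast hM
  simp only [Real.norm_natCast] at h
  have h2 : (M : ℝ) ≤ (M - L M) ^ 2 := by nlinarith
  calc Real.log M ≤ Real.log ((M - L M) ^ 2) := Real.log_le_log (by linarith) h2
    _ = _ := by rw [Real.log_pow]; norm_num

theorem eventually_mul_log_le {L N : ℕ → ℕ} {C : ℝ} (hC : 0 < C)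
    (hL : (fun M => (L M : ℝ)) =o[atTop] (fun M => (M : ℝ))) (hpos : ∀ M, 1 ≤ M → 1 ≤ L M)
    (h : AsympGT (fun M => (N M : ℝ)) (fun M => C * (L M : ℝ) * Real.log ((M : ℝ) - (L M : ℝ)))) :
    ∀ᶠ M : ℕ in atTop, C / 2 * L M * Real.log M ≤ N M := by
  have hlog := eventually_log_le hL
  have hpos' : ∀ᶠ M : ℕ in atTop, 0 < C * (L M : ℝ) * Real.log ((M : ℝ) - (L M : ℝ)) := by
    filter_upwards [hlog, eventually_ge_atTop 2] with M h1 hM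
    have h2 : 0 < Real.log M := Real.log_pos (by exact_mod_cast hM)
    have h3 : (0 : ℝ) < L M := by exact_mod_cast hpos M (by omega)
    have : 0 < Real.log ((M : ℝ) - (L M : ℝ)) := by linarith
    positivity
  -- The degenerate case of `AsympGT`, both functions identically zero, contradicts positivity of
  -- the right-hand side for large `M`.
  rcases h with h | ⟨-, t₀, ht⟩
  · obtain ⟨M, hM⟩ := hpos'.exists
    exact absurd (h M).2 hM.ne'
  filter_upwards [hlog, hpos', eventually_gt_atTop t₀] with M h1 h2 h3
  have h4 := (one_lt_div h2).1 (ht M h3)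
  have h5 : C / 2 * L M * Real.log M ≤ C / 2 * L M * (2 * Real.log ((M : ℝ) - (L M : ℝ))) := by
    gcongr
  linarith

theorem supp_card_pos {M : ℕ} {x : Fin M → ℂ} (hx : 0 < power x) : 1 ≤ (supp x).card := by
  rw [Nat.one_le_iff_ne_zero, Finset.card_ne_zero]
  by_contra h
  rw [Finset.not_nonempty_iff_eq_empty] at h
  have := sum_compl_supp x
  rw [h, Finset.compl_empty] at this
  exact hx.ne' this

end SparseRecovery

end

/-! ### Choice of the constants and passage to the limit -/

theorem mainTheorem11 (γ P ν : ℝ) (hγ₀ : 0 < γ) (hγ₁ : γ < 1) (hP : 0 < P) (hν : 0 < ν) :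
    ∃ C : ℝ, 0 < C ∧ ∃ δ : ℝ, 0 < δ ∧
      ∀ (L N : ℕ → ℕ) (x : ∀ M : ℕ, Fin M → ℂ)
        (sel : ∀ M : ℕ, Finset (Finset (Fin M)) → Finset (Fin M)),
        (∀ M, (SparseRecovery.supp (x M)).card = L M) →
        (fun M => (L M : ℝ)) =o[atTop] (fun M => (M : ℝ)) →
        (∀ M, 1 ≤ M → SparseRecovery.power (x M) = P) →
        (∀ M, SparseRecovery.IsTieBreaking (sel M)) →
        SparseRecovery.AsympGT (fun M => (N M : ℝ))
          (fun M => C * (L M : ℝ) * Real.log ((M : ℝ) - (L M : ℝ))) →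
        SparseRecovery.AsymptoticReliableRecovery γ ν N
          (fun M => SparseRecovery.typicalityDecoder δ ν (L M) (sel M)) x := by
  have hγP : 0 < γ * P := mul_pos hγ₀ hP
  have hν2 : 0 < ν ^ 2 := by positivity
  -- With this `δ`, the level `m = ν ^ 2 + 4 * δ` is the midpoint between `ν ^ 2` and `ν ^ 2 + γ *
  -- P`.
  obtain ⟨δ, hδ, hδP⟩ : ∃ δ : ℝ, 0 < δ ∧ γ * P = 8 * δ := ⟨γ * P / 8, by linarith, by ring⟩
  obtain ⟨m, hm⟩ : ∃ m : ℝ, m = ν ^ 2 + 4 * δ := ⟨_, rfl⟩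
  have hm0 : 0 < m := by linarith
  have hS0 : 0 < ν ^ 2 + 8 * δ := by linarith
  -- The value that turns `m ≤ (ν ^ 2 + γ * P) * (1 - lam * m)` into an equality.
  obtain ⟨lam, hlam, hlm⟩ : ∃ lam : ℝ, 0 < lam ∧ lam * m = 4 * δ / (ν ^ 2 + 8 * δ) :=
    ⟨4 * δ / (ν ^ 2 + 8 * δ) / m, by positivity, by field_simp⟩
  have hlm1 : lam * m ≤ 1 := by
    rw [hlm, div_le_one hS0]; linarith
  have hlm2 : m ≤ (ν ^ 2 + γ * P) * (1 - lam * m) := by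
    rw [hlm, hδP, mul_sub, mul_div_cancel₀ _ hS0.ne']; linarith
  obtain ⟨θ, hθ, hθ₁, hθ₂⟩ : ∃ θ : ℝ, 0 < θ ∧ θ * ν ^ 2 ≤ 1 / 2 ∧ 4 * (θ * ν ^ 4) ≤ δ := by
    refine ⟨min (δ / (4 * ν ^ 4)) (1 / (2 * ν ^ 2)), by positivity, ?_, ?_⟩
    · calc _ ≤ 1 / (2 * ν ^ 2) * ν ^ 2 := by gcongr; exact min_le_right _ _
        _ = 1 / 2 := by field_simp
    · calc _ ≤ 4 * (δ / (4 * ν ^ 4) * ν ^ 4) := by gcongr; exact min_le_left _ _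
        _ = δ := by field_simp
  -- One factor 2 pays for replacing `log (M - L)` by `log M`; the other lets `M ^ L` use up only
  -- half of the exponent `lam * δ * N`.
  refine ⟨4 / (lam * δ), by positivity, δ, hδ, ?_⟩
  intro L N x sel hcard hLo hpow hsel hgt
  have hL1 : ∀ M, 1 ≤ M → 1 ≤ L M := fun M hM => by
    rw [← hcard M]
    exact SparseRecovery.supp_card_pos (by rw [hpow M hM]; exact hP)
  have hNlog := SparseRecovery.eventually_mul_log_le (by positivity) hLo hL1 hgt
  have hlog : Tendsto (fun M : ℕ => Real.log M) atTop atTop :=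
    Real.tendsto_log_atTop.comp tendsto_natCast_atTop_atTop
  have hC2 : 4 / (lam * δ) / 2 = 2 / (lam * δ) := by ring
  rw [hC2] at hNlog
  have hκ : 0 < 2 / (lam * δ) := by positivity
  -- Here `L ≥ 1` is essential: it makes `N` grow at least like `log M`.
  have hNatTop : Tendsto (fun M => (N M : ℝ)) atTop atTop := by
    refine tendsto_atTop_mono' _ ?_ (hlog.const_mul_atTop hκ)
    filter_upwards [hNlog, eventually_ge_atTop 1] with M h1 hM
    refine le_trans ?_ h1
    have hl : (1 : ℝ) ≤ L M := by exact_mod_cast hL1 M hM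
    have h0 : 0 ≤ Real.log M := Real.log_natCast_nonneg M
    have : 0 ≤ 2 / (lam * δ) * Real.log M * (L M - 1) :=
      mul_nonneg (by positivity) (by linarith)
    linarith
  have hNL : ∀ K : ℝ, ∀ᶠ M in atTop, K * L M ≤ N M := fun K => by
    filter_upwards [hNlog, (hlog.const_mul_atTop hκ).eventually_ge_atTop K] with M h1 h2
    refine le_trans (mul_le_mul_of_nonneg_right h2 (L M).cast_nonneg) (le_trans (le_of_eq ?_) h1)
    ring
  have hexp : ∀ a : ℝ, 0 < a → Tendsto (fun M => ENNReal.ofReal (Real.exp (-a * N M))) atTop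
      (𝓝 0) := fun a ha => by
    have h := Real.tendsto_exp_atBot.comp
      (hNatTop.const_mul_atTop_of_neg (neg_neg_of_pos ha))
    simpa using ENNReal.tendsto_ofReal h
  have hlim := ((hexp (θ * δ / 4) (by positivity)).add (hexp (θ * δ / 4) (by positivity))).add
    (hexp (lam * δ / 2) (by positivity))
  simp only [add_zero] at hlim
  refine tendsto_of_tendsto_of_tendsto_of_le_of_le' tendsto_const_nhds hlim
    (Eventually.of_forall fun _ => zero_le) ?_
  filter_upwards [hNlog, hNL 2, hNL (4 * ν ^ 2 / δ), hNatTop.eventually_gt_atTop 0,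
    eventually_ge_atTop 1] with M h1 h2 h3 h4 hM
  have h3' : 4 * L M * ν ^ 2 ≤ N M * δ := by
    rw [div_mul_eq_mul_div, div_le_iff₀ hδ] at h3
    linarith
  refine (SparseRecovery.pErr_le_exp (hsel M) (by exact_mod_cast h4) (hcard M)
    (by exact_mod_cast h2) h3' hθ.le hlam.le hθ₁ hθ₂ hm.ge hlm1
    (by rw [hpow M hM]; exact hlm2)).trans (add_le_add le_rfl ?_)
  have hM' : (0 : ℝ) < M := by exact_mod_cast hM
  have hpowM : (M : ℝ) ^ L M = Real.exp (L M * Real.log M) := by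
    rw [Real.exp_nat_mul, Real.exp_log hM']
  rw [← ENNReal.ofReal_natCast, ← ENNReal.ofReal_pow hM'.le, ← ENNReal.ofReal_mul (by positivity),
    hpowM, ← Real.exp_add]
  refine ENNReal.ofReal_le_ofReal (Real.exp_le_exp.2 ?_)
  have h5 : L M * Real.log M ≤ lam * δ / 2 * N M := by
    have := mul_le_mul_of_nonneg_left h1 (show 0 ≤ lam * δ / 2 by positivity)
    refine le_trans (le_of_eq ?_) this
    field_simp
  linarith
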